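/- All rings have a $1$ and all modules are unital. Let $R$ be a commutative Noetherian ring, let $S$ be a (not necessarily commutative) $R$-algebra that is finitely generated as an $R$-module, and let $M$ and $N$ be finitely generated right $S$-modules, regarded as $R$-modules through $S$. For a ring $A$ and right $A$-modules $U, V$, let $\operatorname{sur}_A(U,V)\in\{0,1,2,\dots\}\cup\{\infty\}$ denote the supremum of the integers $t\ge 0$ for which there is a surjective $A$-linear map $U\to V^{\oplus t}$. Let $j\text{-}\operatorname{Spec}(R)$ be the set of prime ideals of $R$ that are intersections of maximal ideals of $R$, and put $X=j\text{-}\operatorname{Spec}(R)\cap\operatorname{Supp}_R(N)$. Give every subset of $\operatorname{Spec}(R)$ the subspace topology induced by the Zariski topology, and let $\dim$ denote the Krull dimension of a topological space, with $\dim\varnothing=-\infty$. For $\mathfrak p\in X$ let $\dim_X(\mathfrak p)$ be the dimension of $\{\mathfrak q\in X:\mathfrak p\subseteq\mathfrak q\}$. If $\dim X<\infty$, then $$\operatorname{sur}_S(M,N)\;\ge\;\inf\{\operatorname{sur}_{S_{\mathfrak p}}(M_{\mathfrak p},N_{\mathfrak p})-\dim_X(\mathfrak p):\mathfrak p\in X\},$$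 where the infimum is taken in $\mathbb Z\cup\{\pm\infty\}$, and $\inf\varnothing=\infty$. -/

import Mathlib

/-!
Right modules over a ring `S` are left modules over the opposite ring `Sᵐᵒᵖ`, as in Mathlib.
If `S` is an `R`-algebra, the underlying `R`-module of a right `S`-module `M` is expressed by
`[Module R M] [IsScalarTower R Sᵐᵒᵖ M]`.
-/

namespace SurjectiveCapacity

universe u v w

section LocalizedRightModule

variable {R : Type u} [CommRing R] (P : Submonoid R)
variable {S : Type v} [Ring S] [Algebra R S]
variable {M : Type w} [AddCommGroup M] [Module R M] [Module Sᵐᵒᵖ M] [IsScalarTower R Sᵐᵒᵖ M]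

theorem op_smul_smul (r : R) (a : S) (m : M) :
    MulOpposite.op a • (r • m) = r • (MulOpposite.op a • m) := by
  have : SMulCommClass R Sᵐᵒᵖ M := IsScalarTower.to_smulCommClass
  exact (smul_comm r (MulOpposite.op a) m).symm

theorem op_smul_submonoid_smul (s : P) (a : S) (m : M) :
    MulOpposite.op a • (s • m) = s • (MulOpposite.op a • m) :=
  op_smul_smul (s : R) a m

theorem op_smul_algebra_smul (r : R) (a : S) (m : M) :
    MulOpposite.op (r • a) • m = r • (MulOpposite.op a • m) := by
  rw [MulOpposite.op_smul, smul_assoc]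

/-- The map `M → P⁻¹M`, `m ↦ (m a) / (s t)`, for fixed `a : S` and `t : P`, extended to `P⁻¹M`:
`m / s ↦ (m a) / (s t)`. -/
def rightMulFrac (x : LocalizedModule P M) (y : S × P) : LocalizedModule P M :=
  LocalizedModule.liftOn x
    (fun z => LocalizedModule.mk (MulOpposite.op y.1 • z.1) (z.2 * y.2))
    (by
      rintro ⟨m, s⟩ ⟨m', s'⟩ ⟨c, hc⟩
      refine LocalizedModule.mk_eq.mpr ⟨c, ?_⟩
      have h : MulOpposite.op y.1 • (c • s' • m) = MulOpposite.op y.1 • (c • s • m') :=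
        congrArg _ hc
      simp only [op_smul_submonoid_smul] at h
      simp only [mul_comm _ y.2, mul_smul]
      rw [smul_comm c y.2, smul_comm c y.2]
      exact congrArg _ h)

/-- The action of `a / t : P⁻¹S` on `m / s : P⁻¹M` from the right: `(m / s)(a / t) = (m a)/(s t)`. -/
def rightMul (x : LocalizedModule P M) (y : LocalizedModule P S) : LocalizedModule P M :=
  LocalizedModule.liftOn y (fun z => rightMulFrac P x z)
    (by
      rintro ⟨a, t⟩ ⟨a', t'⟩ ⟨c, hc⟩
      induction x with | _ m s
      refine LocalizedModule.mk_eq.mpr ⟨c, ?_⟩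
      have h : MulOpposite.op (c • t' • a) • m = MulOpposite.op (c • t • a') • m :=
        congrArg (fun b : S => MulOpposite.op b • m) hc
      simp only [Submonoid.smul_def, op_smul_algebra_smul] at h
      simp only [Submonoid.smul_def, mul_smul]
      rw [smul_comm (c : R) (s : R), smul_comm (c : R) (s : R)]
      exact congrArg _ h)

/-- The localization `P⁻¹M` of a right `S`-module `M` is a right module over the ring `P⁻¹S`. -/
instance localizedRightModule : Module (LocalizedModule P S)ᵐᵒᵖ (LocalizedModule P M) where
  smul y x := rightMul P x y.unop
  one_smul x := by
    induction x with | _ m s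
    have h : (1 : (LocalizedModule P S)ᵐᵒᵖ) = MulOpposite.op (LocalizedModule.mk 1 1) :=
      congrArg MulOpposite.op OreLocalization.one_def
    rw [h]
    change LocalizedModule.mk (MulOpposite.op (1 : S) • m) (s * 1) = _
    rw [MulOpposite.op_one, one_smul, mul_one]
  mul_smul y y' x := by
    induction y using MulOpposite.rec' with | _ y
    induction y' using MulOpposite.rec' with | _ y'
    induction x with | _ m s
    induction y with | _ a t
    induction y' with | _ a' t'
    change LocalizedModule.mk (MulOpposite.op (a' * a) • m) (s * (t * t'))
      = LocalizedModule.mk (MulOpposite.op a • MulOpposite.op a' • m) (s * t' * t)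
    rw [MulOpposite.op_mul, mul_smul, mul_assoc, mul_comm t t']
  smul_zero y := by
    induction y using MulOpposite.rec' with | _ y
    induction y with | _ a t
    rw [← LocalizedModule.zero_mk (1 : P)]
    change LocalizedModule.mk (MulOpposite.op a • (0 : M)) (1 * t) = _
    rw [smul_zero, LocalizedModule.zero_mk, LocalizedModule.zero_mk]
  smul_add y x x' := by
    induction y using MulOpposite.rec' with | _ y
    induction x with | _ m s
    induction x' with | _ m' s'
    induction y with | _ a t
    rw [LocalizedModule.mk_add_mk]
    change LocalizedModule.mk (MulOpposite.op a • (s' • m + s • m')) (s * s' * t)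
      = LocalizedModule.mk (MulOpposite.op a • m) (s * t)
        + LocalizedModule.mk (MulOpposite.op a • m') (s' * t)
    rw [LocalizedModule.mk_add_mk, smul_add, op_smul_submonoid_smul, op_smul_submonoid_smul]
    refine LocalizedModule.mk_eq.mpr ⟨1, ?_⟩
    simp only [smul_add, smul_smul]
    congr 2 <;> congr 1 <;> ac_rfl
  add_smul y y' x := by
    induction y using MulOpposite.rec' with | _ y
    induction y' using MulOpposite.rec' with | _ y'
    induction x with | _ m s
    induction y with | _ a t
    induction y' with | _ a' t'
    rw [← MulOpposite.op_add, LocalizedModule.mk_add_mk]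
    change LocalizedModule.mk (MulOpposite.op (t' • a + t • a') • m) (s * (t * t'))
      = LocalizedModule.mk (MulOpposite.op a • m) (s * t)
        + LocalizedModule.mk (MulOpposite.op a' • m) (s * t')
    rw [LocalizedModule.mk_add_mk, MulOpposite.op_add, add_smul]
    simp only [Submonoid.smul_def, op_smul_algebra_smul]
    simp only [← Submonoid.smul_def]
    refine LocalizedModule.mk_eq.mpr ⟨1, ?_⟩
    simp only [smul_add, smul_smul]
    congr 2 <;> congr 1 <;> ac_rfl
  zero_smul x := by
    induction x with | _ m s
    rw [← MulOpposite.op_zero, ← LocalizedModule.zero_mk (1 : P)]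
    change LocalizedModule.mk (MulOpposite.op (0 : S) • m) (s * 1) = _
    rw [MulOpposite.op_zero, zero_smul, LocalizedModule.zero_mk]

theorem op_mk_smul_mk (a : S) (t : P) (m : M) (s : P) :
    MulOpposite.op (LocalizedModule.mk a t) • LocalizedModule.mk m s
      = LocalizedModule.mk (MulOpposite.op a • m) (s * t) := rfl

end LocalizedRightModule

/-- `sur_S(M, N)`: the supremum of the `t : ℕ` for which there is a surjective `S`-linear map of
right `S`-modules from `M` to the direct sum of `t` copies of `N`. -/
noncomputable def sur (S : Type u) [Ring S] (M : Type v) [AddCommGroup M] [Module Sᵐᵒᵖ M]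
    (N : Type w) [AddCommGroup N] [Module Sᵐᵒᵖ N] : ℕ∞ :=
  ⨆ t ∈ {t : ℕ | ∃ f : M →ₗ[Sᵐᵒᵖ] (Fin t → N), Function.Surjective f}, (t : ℕ∞)

/-- The set of primes of `R` that are intersections of maximal ideals of `R`. -/
def jSpec (R : Type u) [CommRing R] : Set (PrimeSpectrum R) :=
  {p | ∃ T : Set (Ideal R), (∀ m ∈ T, m.IsMaximal) ∧ p.asIdeal = sInf T}

/-- `dim_X(p)`: the Krull dimension of `V(p) ∩ X` as a topological subspace of `Spec R`. -/
noncomputable def dimAt {R : Type u} [CommRing R] (X : Set (PrimeSpectrum R))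
    (p : PrimeSpectrum R) : WithBot ℕ∞ :=
  topologicalKrullDim ↥({q : PrimeSpectrum R | p.asIdeal ≤ q.asIdeal} ∩ X)

/-- The inclusion of `{-∞} ∪ ℕ ∪ {∞}` into the extended real line. -/
noncomputable def dimToEReal : WithBot ℕ∞ → EReal
  | ⊥ => ⊥
  | (n : ℕ∞) => (n : EReal)

end SurjectiveCapacity

/-! This is a basic element argument in the style of Serre, Swan and Eisenbud–Evans, run on maps.
Let `H` be `Hom_S(M, N)`, viewed as an `R`-submodule of `Hom_R(M, N)`; once `H` is fixed, `S` plays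
no further role. A finite family in `H` has a rank at each prime `p`: the largest `m` such that the
`k(p)`-span of its reductions contains `m` maps jointly surjective onto `(N ⊗ k(p)) ^ m`. By
clearing denominators (`exists_notMem_support_of_surjective`), a local surjection onto `t +
dim_X(p)` copies shows that generators of `H` have rank at least `t + dim_X(p)` at `p`. Conversely,
`t` maps of rank `t` at every point of `X` form a surjection onto `N ^ t`, by Nakayama
(`surjective_pi_of_fibreRank`).

It remains to shorten the family one map at a time, keeping rank at least `min n (t + dim_X(p))` for
`n` maps. Any contraction loses at most one (`SurjRank.contract`), and a well-chosen one loses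
nothing, up to the bound `n`, at finitely many given primes (`exists_contract_fibreRank`). The given
primes are the generic points, within `X`, of the closed loci of small rank. Any other `p` in such a
locus lies strictly above a generic point `q` of it; as `dim_X(q) > dim_X(p)`, the rank required at
`q` excludes this locus, so `p` can afford the loss (`exists_contract_forall_fibreRank`). -/

namespace SurjectiveCapacity

/-! ### Linear algebra over a field: rank of a space of maps, and contractions. -/

section Field

variable {k V W : Type*} [Field k] [AddCommGroup V] [Module k V] [AddCommGroup W] [Module k W]

/-- The space `F` of linear maps `V → W` contains `m` maps that together form a surjection
`V → W ^ m`. -/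
def SurjRank (m : ℕ) (F : Submodule k (V →ₗ[k] W)) : Prop :=
  ∃ h : Fin m → V →ₗ[k] W, (∀ i, h i ∈ F) ∧ Function.Surjective (LinearMap.pi h)

/-- Reindexing the components of a surjection onto a power along an injection. -/
theorem surjective_pi_comp {A ι κ V W : Type*} [Ring A] [AddCommGroup V] [Module A V]
    [AddCommGroup W] [Module A W] {h : ι → V →ₗ[A] W} (hs : Function.Surjective (LinearMap.pi h))
    {e : κ → ι} (he : Function.Injective e) :
    Function.Surjective (LinearMap.pi fun j => h (e j)) := by
  intro w
  obtain ⟨v, hv⟩ := hs (Function.extend e w 0)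
  refine ⟨v, funext fun j => ?_⟩
  have := congrFun hv (e j)
  rwa [he.extend_apply] at this

theorem SurjRank.mono {m m' : ℕ} (hm : m' ≤ m) {F : Submodule k (V →ₗ[k] W)} (h : SurjRank m F) :
    SurjRank m' F := by
  obtain ⟨h, hF, hs⟩ := h
  exact ⟨fun i => h (Fin.castLE hm i), fun i => hF _,
    surjective_pi_comp hs (Fin.castLE_injective hm)⟩

theorem SurjRank.mono_right {m : ℕ} {F F' : Submodule k (V →ₗ[k] W)} (hF : F ≤ F')
    (h : SurjRank m F) : SurjRank m F' := by
  obtain ⟨h, hF', hs⟩ := h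
  exact ⟨h, fun i => hF (hF' i), hs⟩

/-- Enlarging the space of maps by one dimension raises the rank by at most one. -/
theorem SurjRank.of_sup_span_singleton {m : ℕ} {F : Submodule k (V →ₗ[k] W)} {g : V →ₗ[k] W}
    (h : SurjRank (m + 1) (F ⊔ Submodule.span k {g})) : SurjRank m F := by
  obtain ⟨h, hF, hs⟩ := h
  have : ∀ i, ∃ h' ∈ F, ∃ b : k, h i = h' + b • g := fun i => by
    obtain ⟨x, hx, y, hy, hxy⟩ := Submodule.mem_sup.mp (hF i)
    obtain ⟨b, rfl⟩ := Submodule.mem_span_singleton.mp hy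
    exact ⟨x, hx, b, hxy.symm⟩
  choose h' hh' b hb using this
  -- A pivot component in which `g` occurs clears `g` from all the others; if `g` occurs nowhere,
  -- any pivot works with `c = 0`.
  obtain ⟨i₀, c, hc⟩ : ∃ i₀, ∃ c : Fin m → k, ∀ j, b (i₀.succAbove j) = c j * b i₀ := by
    by_cases hb0 : ∃ i, b i ≠ 0
    · obtain ⟨i₀, hi⟩ := hb0
      exact ⟨i₀, fun j => b (i₀.succAbove j) / b i₀, fun j => (div_mul_cancel₀ _ hi).symm⟩
    · push Not at hb0
      exact ⟨0, 0, fun j => by simp [hb0]⟩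
  refine ⟨fun j => h' (i₀.succAbove j) - c j • h' i₀,
    fun j => F.sub_mem (hh' _) (F.smul_mem _ (hh' _)), fun w => ?_⟩
  obtain ⟨v, hv⟩ := hs (i₀.insertNth 0 w)
  refine ⟨v, funext fun j => ?_⟩
  have h1 := congrFun hv i₀
  have h2 := congrFun hv (i₀.succAbove j)
  simp only [LinearMap.pi_apply, hb, Fin.insertNth_apply_same, Fin.insertNth_apply_succAbove,
    LinearMap.add_apply, LinearMap.smul_apply, hc] at h1 h2
  simp only [LinearMap.pi_apply, LinearMap.sub_apply, LinearMap.smul_apply]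
  rw [← h2, eq_neg_of_add_eq_zero_left h1, mul_smul, smul_neg, sub_neg_eq_add]

/-- Replace a family of `n + 1` elements by `n` combinations: `f_j + a_j (f_n + ∑ y_l f_l)`. -/
def contract {A E : Type*} [CommRing A] [AddCommGroup E] [Module A E] {n : ℕ}
    (f : Fin (n + 1) → E) (x : Fin n ⊕ Fin n → A) (j : Fin n) : E :=
  f j.castSucc + x (.inl j) • (f (Fin.last n) + ∑ l, x (.inr l) • f l.castSucc)

/-- A contraction together with the single element `g = f_n + ∑ y_l f_l` recovers every `f_j`, so
contracting costs at most one dimension of the span. -/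
theorem span_le_span_contract {E : Type*} [AddCommGroup E] [Module k E] {n : ℕ}
    (f : Fin (n + 1) → E) (x : Fin n ⊕ Fin n → k) :
    Submodule.span k (Set.range f) ≤ Submodule.span k (Set.range (contract f x)) ⊔
      Submodule.span k {f (Fin.last n) + ∑ l, x (.inr l) • f l.castSucc} := by
  set g := f (Fin.last n) + ∑ l, x (.inr l) • f l.castSucc with hg
  have hgm : g ∈ Submodule.span k (Set.range (contract f x)) ⊔ Submodule.span k {g} :=
    Submodule.mem_sup_right (Submodule.mem_span_singleton_self g)
  have hc : ∀ j : Fin n, f j.castSucc ∈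
      Submodule.span k (Set.range (contract f x)) ⊔ Submodule.span k {g} := fun j => by
    have : f j.castSucc = contract f x j - x (.inl j) • g := by simp [contract, hg]
    rw [this]
    exact sub_mem (Submodule.mem_sup_left (Submodule.subset_span ⟨j, rfl⟩))
      (Submodule.smul_mem _ _ hgm)
  rw [Submodule.span_le]
  rintro _ ⟨j, rfl⟩
  induction j using Fin.lastCases with
  | cast j => exact hc j
  | last =>
    have : f (Fin.last n) = g - ∑ l, x (.inr l) • f l.castSucc := by simp [hg]
    rw [this]
    exact sub_mem hgm (Submodule.sum_mem _ fun l _ => Submodule.smul_mem _ _ (hc l))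

theorem SurjRank.contract {m n : ℕ} {f : Fin (n + 1) → V →ₗ[k] W}
    (h : SurjRank (m + 1) (Submodule.span k (Set.range f))) (x : Fin n ⊕ Fin n → k) :
    SurjRank m (Submodule.span k (Set.range (contract f x))) :=
  (h.mono_right (span_le_span_contract f x)).of_sup_span_singleton

/-- At most `n` elements in the span of `n + 1` vectors lie in the span of a suitable
contraction. -/
theorem exists_contract {E : Type*} [AddCommGroup E] [Module k E] {m n : ℕ} (hmn : m ≤ n)
    (f : Fin (n + 1) → E) (h : Fin m → E) (hh : ∀ i, h i ∈ Submodule.span k (Set.range f)) :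
    ∃ x : Fin n ⊕ Fin n → k, ∃ C : Fin m → Fin n → k, ∀ i, h i = ∑ j, C i j • contract f x j := by
  have : ∀ i, ∃ c : Fin (n + 1) → k, ∑ j, c j • f j = h i := fun i =>
    (Submodule.mem_span_range_iff_exists_fun k).mp (hh i)
  choose c hc using this
  let B : Matrix (Fin m) (Fin n) k := fun i j => c i j.castSucc
  let b : Fin m → k := fun i => c i (Fin.last n)
  have hB : ∀ i, h i = ∑ j, B i j • f j.castSucc + b i • f (Fin.last n) := fun i => by
    rw [← hc, Fin.sum_univ_castSucc]
  -- Comparing coefficients of the `f_j`, the family `h` with coefficients `(B | b)` is `C` applied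
  -- to the contraction as soon as `C a = b` and `B = C + b yᵀ`.
  have key : ∀ (C : Matrix (Fin m) (Fin n) k) (a y : Fin n → k),
      (∀ i, ∑ j, C i j * a j = b i) → (∀ i j, B i j = C i j + b i * y j) →
      ∀ i, h i = ∑ j, C i j • SurjectiveCapacity.contract f (Sum.elim a y) j := by
    intro C a y h1 h2 i
    simp only [SurjectiveCapacity.contract, smul_add, Finset.sum_add_distrib, Sum.elim_inl,
      Sum.elim_inr, hB, h2, add_smul, smul_smul, ← Finset.sum_smul]
    rw [h1, Finset.smul_sum]
    simp only [smul_smul]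
    abel
  -- If `B` is injective, `m ≤ n` makes it bijective, and `y = 0`, `C = B` works. Otherwise take `v
  -- ≠ 0` in the kernel and `y` with `y · v = 1`; then `C = B - b yᵀ` and `a = -v` give `C a = b`.
  by_cases hinj : Function.Injective B.mulVecLin
  · have hsurj : Function.Surjective B.mulVecLin := by
      have h1 := LinearMap.finrank_range_of_inj hinj
      have h2 := Submodule.finrank_le (LinearMap.range B.mulVecLin)
      rw [← LinearMap.range_eq_top]
      apply Submodule.eq_top_of_finrank_eq
      simp only [Module.finrank_fin_fun] at *
      omega
    obtain ⟨a, ha⟩ := hsurj b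
    exact ⟨Sum.elim a 0, B, key B a 0 (fun i => congrFun ha i) (by simp)⟩
  · obtain ⟨v, hv, hv0⟩ : ∃ v, B.mulVecLin v = 0 ∧ v ≠ 0 := by
      rw [injective_iff_map_eq_zero] at hinj
      push Not at hinj
      exact hinj
    obtain ⟨j₀, hj₀⟩ := Function.ne_iff.mp hv0
    have hBv : ∀ i, ∑ j, B i j * v j = 0 := fun i => congrFun hv i
    let y : Fin n → k := Pi.single j₀ (v j₀)⁻¹
    have hyv : ∑ j, y j * v j = 1 := by
      rw [Finset.sum_eq_single j₀]
      · simp only [y, Pi.single_eq_same]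
        exact inv_mul_cancel₀ hj₀
      · intro j _ hj
        simp [y, Pi.single_eq_of_ne hj]
      · simp
    refine ⟨Sum.elim (-v) y, fun i j => B i j - b i * y j, key _ _ _ (fun i => ?_) (by simp)⟩
    simp only [Pi.neg_apply, mul_neg, sub_mul, Finset.sum_neg_distrib, Finset.sum_sub_distrib,
      hBv, mul_assoc, ← Finset.mul_sum, hyv]
    simp

/-- On the line `u + c v`, surjectivity fails at finitely many points or everywhere. -/
theorem finite_not_surjective_line [FiniteDimensional k W] {u v : V →ₗ[k] W}
    {c₀ : k} (h : Function.Surjective (u + c₀ • v)) :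
    {c : k | ¬ Function.Surjective (u + c • v)}.Finite := by
  -- With `s` a section of `u + c₀ v`, the composite `(u + c v) s` is `1 + (c - c₀) v s`, an
  -- endomorphism of `W` that is invertible unless `-(c - c₀)⁻¹` is one of the finitely many
  -- eigenvalues of `v s`.
  obtain ⟨s, hs⟩ := (u + c₀ • v).exists_rightInverse_of_surjective (LinearMap.range_eq_top.mpr h)
  have hfin := Module.End.finite_spectrum (v ∘ₗ s)
  refine Set.Finite.subset (hfin.image fun μ => c₀ - μ⁻¹) fun c hc => ?_
  have hcc : c - c₀ ≠ 0 := fun hc0 => hc (by rwa [sub_eq_zero.mp hc0])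
  refine ⟨-(c - c₀)⁻¹, fun hu => hc ?_, by simp⟩
  have h1 : (u + c • v) ∘ₗ s =
      (-(c - c₀)) • (algebraMap k (Module.End k W) (-(c - c₀)⁻¹) - v ∘ₗ s) := by
    have : u + c • v = (u + c₀ • v) + (c - c₀) • v := by rw [sub_smul]; abel
    rw [this, LinearMap.add_comp, hs, LinearMap.smul_comp, smul_sub, Algebra.algebraMap_eq_smul_one,
      smul_smul, neg_mul_neg, mul_inv_cancel₀ hcc, one_smul, neg_smul, sub_neg_eq_add]
    rfl
  have h2 : Function.Surjective ((u + c • v) ∘ₗ s) := by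
    rw [h1]
    have := ((Module.End.isUnit_iff _).mp hu).2
    intro w
    obtain ⟨z, hz⟩ := this ((-(c - c₀))⁻¹ • w)
    refine ⟨z, ?_⟩
    rw [LinearMap.smul_apply, hz, smul_inv_smul₀ (neg_ne_zero.mpr hcc)]
  exact Function.Surjective.of_comp (g := s) (by simpa using h2)

/-- A family of `n` maps whose span has rank `n` is jointly surjective. -/
theorem SurjRank.surjective_pi [FiniteDimensional k W] {n : ℕ} {f : Fin n → V →ₗ[k] W}
    (h : SurjRank n (Submodule.span k (Set.range f))) : Function.Surjective (LinearMap.pi f) := by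
  obtain ⟨h, hF, hs⟩ := h
  have : ∀ i, ∃ c : Fin n → k, ∑ j, c j • f j = h i := fun i =>
    (Submodule.mem_span_range_iff_exists_fun k).mp (hF i)
  choose c hc using this
  -- The jointly surjective `h` factors as `B ∘ f`, so `B` is onto, hence injective by finite
  -- dimension, and can be cancelled.
  let B : (Fin n → W) →ₗ[k] (Fin n → W) :=
    LinearMap.pi fun i => ∑ j, c i j • LinearMap.proj j
  have hB : ∀ v, B (LinearMap.pi f v) = LinearMap.pi h v := fun v => funext fun i => by
    simp [B, ← hc, LinearMap.sum_apply]
  have hBs : Function.Surjective B := fun w => by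
    obtain ⟨v, hv⟩ := hs w
    exact ⟨_, (hB v).trans hv⟩
  have hBi : Function.Injective B := LinearMap.injective_iff_surjective.mpr hBs
  intro w
  obtain ⟨v, hv⟩ := hs (B w)
  exact ⟨v, hBi ((hB v).trans hv)⟩

end Field

open TensorProduct

/-! ### Lifting generic choices from residue fields to the ring. -/

section Lift

variable {R : Type*} [CommRing R]

theorem algebraMap_residueField_eq_zero_iff (p : PrimeSpectrum R) (r : R) :
    algebraMap R p.asIdeal.ResidueField r = 0 ↔ r ∈ p.asIdeal :=
  Ideal.algebraMap_residueField_eq_zero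

/-- Inside the residue field of `p`, the coset of multiples of `r ∉ p` is everything or infinite. -/
theorem exists_notMem_of_finite (p : PrimeSpectrum R) {r : R} (hr : r ∉ p.asIdeal) (a : R)
    {B : Set p.asIdeal.ResidueField} (hB : B.Finite) (hB' : Bᶜ.Nonempty) :
    ∃ z : R, algebraMap R p.asIdeal.ResidueField (a + r * z) ∉ B := by
  have hr' : algebraMap R p.asIdeal.ResidueField r ≠ 0 := fun h =>
    hr ((algebraMap_residueField_eq_zero_iff p r).mp h)
  by_contra! hcon
  -- If all these values fell in `B`, the image of `R` in the residue field would be finite; then `R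
  -- ⧸ p` is a finite domain, hence a field, and `R` maps onto the residue field, so a value outside
  -- `B` is attained after all.
  have hfin : (Set.range (algebraMap R p.asIdeal.ResidueField)).Finite := by
    refine (hB.image fun b => (b - algebraMap R p.asIdeal.ResidueField a) /
      algebraMap R p.asIdeal.ResidueField r).subset ?_
    rintro _ ⟨z, rfl⟩
    refine ⟨_, hcon z, ?_⟩
    dsimp only
    rw [map_add, map_mul, add_sub_cancel_left, mul_div_cancel_left₀ _ hr']
  have hsurj : Function.Surjective (algebraMap R p.asIdeal.ResidueField) := by
    have hfin' : Finite (R ⧸ p.asIdeal) := by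
      have hinj : Function.Injective (algebraMap (R ⧸ p.asIdeal) p.asIdeal.ResidueField) :=
        IsFractionRing.injective (R ⧸ p.asIdeal) p.asIdeal.ResidueField
      have : Set.range (algebraMap (R ⧸ p.asIdeal) p.asIdeal.ResidueField) ⊆
          Set.range (algebraMap R p.asIdeal.ResidueField) := by
        rintro _ ⟨y, rfl⟩
        obtain ⟨y, rfl⟩ := Ideal.Quotient.mk_surjective y
        exact ⟨y, rfl⟩
      have := Set.finite_coe_iff.mpr (hfin.subset this)
      exact Finite.of_injective_finite_range hinj
    have hfield : IsField (R ⧸ p.asIdeal) := Finite.isField_of_domain _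
    intro y
    obtain ⟨x, hx⟩ := IsFractionRing.surjective_iff_isField.mpr hfield y
    obtain ⟨x, rfl⟩ := Ideal.Quotient.mk_surjective x
    exact ⟨x, hx⟩
  obtain ⟨b, hb⟩ := hB'
  obtain ⟨z, hz⟩ := hsurj
    ((b - algebraMap R p.asIdeal.ResidueField a) / algebraMap R p.asIdeal.ResidueField r)
  refine hb ?_
  have := hcon z
  rwa [map_add, map_mul, hz, mul_div_cancel₀ _ hr', add_sub_cancel] at this

/-- A nonempty set of tuples over the residue field of `p` that is cofinite or empty on every
coordinate line meets the image of `x + r R ^ ι`, if `r ∉ p`. -/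
theorem exists_add_mul_mem {ι : Type*} [Finite ι] (p : PrimeSpectrum R) {r : R}
    (hr : r ∉ p.asIdeal) (x : ι → R) {G : Set (ι → p.asIdeal.ResidueField)} (hG : G.Nonempty)
    (hline : ∀ y ∈ G, ∀ i, {c | open Classical in Function.update y i c ∉ G}.Finite) :
    ∃ z : ι → R, (fun i => algebraMap R p.asIdeal.ResidueField (x i + r * z i)) ∈ G := by
  classical
  cases nonempty_fintype ι
  -- Coordinates are replaced one at a time by images from `R`; each replacement stays in `G`, so
  -- the line condition applies again.
  have key : ∀ s : Finset ι, ∃ y ∈ G, ∀ i ∈ s, ∃ z : R,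
      algebraMap R p.asIdeal.ResidueField (x i + r * z) = y i := by
    intro s
    induction s using Finset.induction_on with
    | empty => exact ⟨hG.some, hG.some_mem, by simp⟩
    | insert i s hi ih =>
      obtain ⟨y, hy, hs⟩ := ih
      obtain ⟨z, hz⟩ := exists_notMem_of_finite p hr (x i) (hline y hy i)
        ⟨y i, by simpa using hy⟩
      refine ⟨Function.update y i (algebraMap R _ (x i + r * z)), ?_, fun j hj => ?_⟩
      · simp only [Set.mem_ofPred_eq, not_not] at hz
        convert hz
      · by_cases hji : j = i
        · subst hji
          exact ⟨z, by simp⟩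
        · rw [Function.update_of_ne hji]
          exact hs j (Finset.mem_of_mem_insert_of_ne hj hji)
  obtain ⟨y, hy, hs⟩ := key Finset.univ
  choose z hz using fun i => hs i (Finset.mem_univ i)
  refine ⟨z, ?_⟩
  convert hy using 1
  exact funext hz

/-- Finitely many open conditions over the residue fields of different primes can be met by one
tuple over `R`. -/
theorem exists_mem_of_finset {ι : Type*} [Finite ι] (Λ : Finset (PrimeSpectrum R))
    (G : ∀ p : PrimeSpectrum R, Set (ι → p.asIdeal.ResidueField)) (hG : ∀ p ∈ Λ, (G p).Nonempty)
    (hline : ∀ p ∈ Λ, ∀ y ∈ G p, ∀ i, {c | open Classical in Function.update y i c ∉ G p}.Finite) :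
    ∃ x : ι → R, ∀ p ∈ Λ, (fun i => algebraMap R p.asIdeal.ResidueField (x i)) ∈ G p := by
  classical
  induction hn : Λ.card generalizing Λ with
  | zero => exact ⟨0, by simp [Finset.card_eq_zero.mp hn]⟩
  | succ n ih =>
    have hne : Λ.Nonempty := Finset.card_pos.mp (by omega)
    -- Minimality of `p` gives an element outside `p` lying in all the other primes; adding its
    -- multiples adjusts `x` at `p` without changing it at the others.
    obtain ⟨p, hp⟩ := Λ.exists_minimal hne
    obtain ⟨x, hx⟩ := ih (Λ.erase p) (fun q hq => hG q (Finset.mem_of_mem_erase hq))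
      (fun q hq => hline q (Finset.mem_of_mem_erase hq)) (by
        rw [Finset.card_erase_of_mem hp.prop, hn, Nat.add_sub_cancel])
    have hr : ∀ q ∈ Λ.erase p, ∃ r ∈ q.asIdeal, r ∉ p.asIdeal := fun q hq => by
      by_contra! hqp
      have h1 : q ≤ p := hqp
      exact Finset.ne_of_mem_erase hq (le_antisymm h1 (hp.2 (Finset.mem_of_mem_erase hq) h1))
    choose! r hrq hrp using hr
    have hprod : ∏ q ∈ Λ.erase p, r q ∉ p.asIdeal := fun h => by
      obtain ⟨q, hq, h⟩ := (Ideal.IsPrime.prod_mem_iff (hp := p.isPrime)).mp h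
      exact hrp q hq h
    obtain ⟨z, hz⟩ := exists_add_mul_mem p hprod x (hG p hp.prop) (hline p hp.prop)
    refine ⟨fun i => x i + (∏ q ∈ Λ.erase p, r q) * z i, fun q hq => ?_⟩
    by_cases hqp : q = p
    · subst hqp
      exact hz
    · have hq' : q ∈ Λ.erase p := Finset.mem_erase.mpr ⟨hqp, hq⟩
      convert hx q hq' using 2 with i
      have : algebraMap R q.asIdeal.ResidueField (∏ q ∈ Λ.erase p, r q) = 0 :=
        (algebraMap_residueField_eq_zero_iff q _).mpr
          (Ideal.mem_of_dvd _ (Finset.dvd_prod_of_mem r hq') (hrq q hq'))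
      rw [map_add, map_mul, this, zero_mul, add_zero]

end Lift

/-! ### Rank of a family of maps at a prime. -/

section Fibre

variable {R : Type*} [CommRing R] {M N : Type*} [AddCommGroup M] [Module R M]
  [AddCommGroup N] [Module R N]

/-- Tensoring is right exact, and by Nakayama the fibre of the finitely generated cokernel vanishes
exactly off its support. -/
theorem surjective_baseChange_residueField_iff [Module.Finite R N] (φ : M →ₗ[R] N)
    (p : PrimeSpectrum R) :
    Function.Surjective (φ.baseChange p.asIdeal.ResidueField) ↔
      p ∉ Module.support R (N ⧸ LinearMap.range φ) := by
  set k := p.asIdeal.ResidueField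
  have hex : Function.Exact (φ.lTensor k) ((LinearMap.range φ).mkQ.lTensor k) :=
    lTensor_exact k (LinearMap.exact_map_mkQ_range φ) (Submodule.mkQ_surjective _)
  have hs : Function.Surjective ((LinearMap.range φ).mkQ.lTensor k) :=
    LinearMap.lTensor_surjective k (Submodule.mkQ_surjective _)
  rw [Module.mem_support_iff_nontrivial_residueField_tensorProduct,
    not_nontrivial_iff_subsingleton]
  constructor
  · intro h
    refine subsingleton_of_forall_eq 0 fun y => ?_
    obtain ⟨y, rfl⟩ := hs y
    exact (hex y).mpr (h y)
  · intro h y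
    exact (hex y).mp (Subsingleton.elim _ _)

theorem surjective_pi_baseChange_iff {A : Type*} [CommRing A] [Algebra R A] {m : ℕ}
    (h : Fin m → M →ₗ[R] N) :
    Function.Surjective (LinearMap.pi fun i => (h i).baseChange A) ↔
      Function.Surjective ((LinearMap.pi h).baseChange A) := by
  have : (LinearMap.pi fun i => (h i).baseChange A) =
      (TensorProduct.piRight R A A fun _ : Fin m => N).toLinearMap ∘ₗ
        (LinearMap.pi h).baseChange A := by
    ext x
    simp
  rw [this, LinearMap.coe_comp, LinearEquiv.coe_coe]
  exact (EquivLike.comp_surjective _ (TensorProduct.piRight R A A fun _ : Fin m => N))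

/-- The rank of a family of maps `M → N` at the prime `p` is at least `m`. -/
def FibreRank (p : PrimeSpectrum R) (m : ℕ) {n : ℕ} (f : Fin n → M →ₗ[R] N) : Prop :=
  SurjRank m (Submodule.span p.asIdeal.ResidueField
    (Set.range fun j => (f j).baseChange p.asIdeal.ResidueField))

theorem exists_smul_eq_baseChange (p : PrimeSpectrum R) {n : ℕ} (f : Fin n → M →ₗ[R] N)
    {g : p.asIdeal.ResidueField ⊗[R] M →ₗ[p.asIdeal.ResidueField] p.asIdeal.ResidueField ⊗[R] N}
    (hg : g ∈ Submodule.span p.asIdeal.ResidueField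
      (Set.range fun j => (f j).baseChange p.asIdeal.ResidueField)) :
    ∃ r ∉ p.asIdeal, ∃ h ∈ Submodule.span R (Set.range f),
      h.baseChange p.asIdeal.ResidueField = r • g := by
  induction hg using Submodule.span_induction with
  | mem g hg =>
    obtain ⟨j, rfl⟩ := hg
    exact ⟨1, p.asIdeal.one_notMem, f j, Submodule.subset_span ⟨j, rfl⟩, by simp⟩
  | zero => exact ⟨1, p.asIdeal.one_notMem, 0, zero_mem _, by simp⟩
  | add g g' _ _ ih ih' =>
    obtain ⟨r, hr, h, hh, e⟩ := ih
    obtain ⟨r', hr', h', hh', e'⟩ := ih'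
    refine ⟨r * r', fun hm => (p.isPrime.mem_or_mem hm).elim hr hr', r' • h + r • h',
      add_mem (Submodule.smul_mem _ _ hh) (Submodule.smul_mem _ _ hh'), ?_⟩
    rw [LinearMap.baseChange_add, LinearMap.baseChange_smul, LinearMap.baseChange_smul, e, e',
      smul_smul, smul_smul, smul_add, mul_comm r' r]
  | smul c g _ ih =>
    obtain ⟨r, hr, h, hh, e⟩ := ih
    obtain ⟨a, b, hb, rfl⟩ := IsFractionRing.div_surjective (A := R ⧸ p.asIdeal) c
    obtain ⟨a, rfl⟩ := Ideal.Quotient.mk_surjective a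
    obtain ⟨b, rfl⟩ := Ideal.Quotient.mk_surjective b
    have hb0 : b ∉ p.asIdeal := fun hb' =>
      nonZeroDivisors.ne_zero hb (Ideal.Quotient.eq_zero_iff_mem.mpr hb')
    refine ⟨r * b, fun hm => (p.isPrime.mem_or_mem hm).elim hr hb0, a • h,
      Submodule.smul_mem _ _ hh, ?_⟩
    have hb1 : algebraMap R p.asIdeal.ResidueField b ≠ 0 := fun h =>
      hb0 ((algebraMap_residueField_eq_zero_iff p b).mp h)
    have hab : algebraMap R p.asIdeal.ResidueField b *
        (algebraMap (R ⧸ p.asIdeal) p.asIdeal.ResidueField (Ideal.Quotient.mk _ a) /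
          algebraMap (R ⧸ p.asIdeal) p.asIdeal.ResidueField (Ideal.Quotient.mk _ b)) =
        algebraMap R p.asIdeal.ResidueField a := mul_div_cancel₀ _ hb1
    rw [LinearMap.baseChange_smul, e, smul_comm a r, ← algebraMap_smul p.asIdeal.ResidueField a g,
      ← hab, mul_smul, algebraMap_smul, mul_smul]

/-- Rescaling components by units of the residue field preserves joint surjectivity, so the
witnesses may be taken in the `R`-span. Rank thus becomes a condition on supports of cokernels,
which are closed. -/
theorem fibreRank_iff [Module.Finite R N] {p : PrimeSpectrum R} {m n : ℕ}
    {f : Fin n → M →ₗ[R] N} :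
    FibreRank p m f ↔ ∃ h : Fin m → M →ₗ[R] N, (∀ i, h i ∈ Submodule.span R (Set.range f)) ∧
      p ∉ Module.support R ((Fin m → N) ⧸ LinearMap.range (LinearMap.pi h)) := by
  constructor
  · rintro ⟨g, hg, hs⟩
    choose r hr h hh e using fun i => exists_smul_eq_baseChange p f (hg i)
    refine ⟨h, hh, ?_⟩
    rw [← surjective_baseChange_residueField_iff, ← surjective_pi_baseChange_iff]
    intro w
    obtain ⟨v, hv⟩ := hs fun i => (algebraMap R p.asIdeal.ResidueField (r i))⁻¹ • w i
    refine ⟨v, funext fun i => ?_⟩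
    have h1 := congrFun hv i
    rw [LinearMap.pi_apply] at h1
    rw [LinearMap.pi_apply, e, LinearMap.smul_apply, h1,
      ← algebraMap_smul p.asIdeal.ResidueField (r i), smul_inv_smul₀]
    exact fun h => hr i ((algebraMap_residueField_eq_zero_iff p _).mp h)
  · rintro ⟨h, hh, hs⟩
    rw [← surjective_baseChange_residueField_iff, ← surjective_pi_baseChange_iff] at hs
    refine ⟨_, fun i => ?_, hs⟩
    refine Submodule.span_induction (p := fun g _ =>
      g.baseChange p.asIdeal.ResidueField ∈ Submodule.span p.asIdeal.ResidueField
        (Set.range fun j => (f j).baseChange p.asIdeal.ResidueField))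
      ?_ ?_ ?_ ?_ (hh i)
    · rintro _ ⟨j, rfl⟩
      exact Submodule.subset_span ⟨j, rfl⟩
    · rw [LinearMap.baseChange_zero]
      exact zero_mem _
    · intro x y _ _ hx hy
      rw [LinearMap.baseChange_add]
      exact add_mem hx hy
    · intro a x _ hx
      rw [LinearMap.baseChange_smul, ← algebraMap_smul p.asIdeal.ResidueField a]
      exact Submodule.smul_mem _ _ hx

theorem isClosed_setOf_not_fibreRank [Module.Finite R N] (m : ℕ) {n : ℕ}
    (f : Fin n → M →ₗ[R] N) : IsClosed {p | ¬ FibreRank p m f} := by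
  have : {p | ¬ FibreRank p m f} = ⋂ h : {h : Fin m → M →ₗ[R] N //
      ∀ i, h i ∈ Submodule.span R (Set.range f)},
      Module.support R ((Fin m → N) ⧸ LinearMap.range (LinearMap.pi h.1)) := by
    ext p
    simp only [fibreRank_iff, Set.mem_ofPred_eq, Set.mem_iInter, Subtype.forall]
    push Not
    rfl
  rw [this]
  exact isClosed_iInter fun h => Module.isClosed_support

theorem FibreRank.mono {p : PrimeSpectrum R} {m m' n : ℕ} (hm : m' ≤ m)
    {f : Fin n → M →ₗ[R] N} (h : FibreRank p m f) : FibreRank p m' f :=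
  SurjRank.mono hm h

theorem baseChange_contract {A : Type*} [CommRing A] [Algebra R A] {n : ℕ}
    (f : Fin (n + 1) → M →ₗ[R] N) (x : Fin n ⊕ Fin n → R) (j : Fin n) :
    (contract f x j).baseChange A =
      contract (fun j => (f j).baseChange A) (fun i => algebraMap R A (x i)) j := by
  simp only [contract, LinearMap.baseChange_add, LinearMap.baseChange_smul, algebraMap_smul]
  congr 3
  rw [← LinearMap.baseChangeHom_apply, map_sum]
  simp

theorem FibreRank.contract {p : PrimeSpectrum R} {m n : ℕ} {f : Fin (n + 1) → M →ₗ[R] N}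
    (h : FibreRank p (m + 1) f) (x : Fin n ⊕ Fin n → R) : FibreRank p m (contract f x) := by
  unfold FibreRank
  simp only [baseChange_contract]
  exact SurjRank.contract h _

/-- Each coordinate enters a contraction to degree at most one, so varying it traces a line to which
`finite_not_surjective_line` applies. -/
theorem exists_update_contract {k E : Type*} [Field k] [AddCommGroup E] [Module k E] {n : ℕ}
    (f : Fin (n + 1) → E) (x : Fin n ⊕ Fin n → k) (i : Fin n ⊕ Fin n) :
    ∃ u v : Fin n → E, ∀ c j, SurjectiveCapacity.contract f (Function.update x i c) j =
      u j + c • v j := by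
  rcases i with i | i
  · refine ⟨fun j => SurjectiveCapacity.contract f (Function.update x (.inl i) 0) j,
      fun j => if j = i then f (Fin.last n) + ∑ l, x (.inr l) • f l.castSucc else 0,
      fun c j => ?_⟩
    by_cases hj : j = i
    · subst hj
      simp [SurjectiveCapacity.contract]
    · simp [SurjectiveCapacity.contract, hj]
  · refine ⟨fun j => SurjectiveCapacity.contract f (Function.update x (.inr i) 0) j,
      fun j => x (.inl j) • f i.castSucc, fun c j => ?_⟩
    have : ∀ c : k, ∑ l, (Function.update x (.inr i) c) (.inr l) • f l.castSucc =
        c • f i.castSucc + ∑ l ∈ Finset.univ.erase i, x (.inr l) • f l.castSucc := fun c => by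
      rw [← Finset.add_sum_erase _ _ (Finset.mem_univ i)]
      congr 1
      · simp
      · exact Finset.sum_congr rfl fun l hl => by
          rw [Function.update_of_ne (by simpa using Finset.ne_of_mem_erase hl)]
    simp only [SurjectiveCapacity.contract, this]
    simp only [ne_eq, reduceCtorEq, not_false_eq_true, Function.update_of_ne, zero_smul,
      smul_add, smul_comm c, smul_zero]
    abel

/-- A family of `n + 1` maps can be contracted to `n` maps without loss of rank at finitely many
primes, up to the bound `n`. -/
theorem exists_contract_fibreRank [Module.Finite R N] {n : ℕ} (f : Fin (n + 1) → M →ₗ[R] N)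
    (Λ : Finset (PrimeSpectrum R)) (m : PrimeSpectrum R → ℕ)
    (hm : ∀ p ∈ Λ, m p ≤ n) (h : ∀ p ∈ Λ, FibreRank p (m p) f) :
    ∃ x : Fin n ⊕ Fin n → R, ∀ p ∈ Λ, FibreRank p (m p) (SurjectiveCapacity.contract f x) := by
  have key : ∀ p ∈ Λ, ∃ C : Fin (m p) → Fin n → p.asIdeal.ResidueField,
      ∃ x : Fin n ⊕ Fin n → p.asIdeal.ResidueField, Function.Surjective (LinearMap.pi fun i =>
        ∑ j, C i j • SurjectiveCapacity.contract
          (fun j => (f j).baseChange p.asIdeal.ResidueField) x j) := by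
    intro p hp
    obtain ⟨g, hg, hs⟩ := h p hp
    obtain ⟨x, C, hC⟩ := exists_contract (hm p hp) _ g hg
    refine ⟨C, x, ?_⟩
    simpa only [← hC] using hs
  choose! C x₀ hx₀ using key
  -- The coefficients `C p` stay frozen while `x` varies; otherwise the joint map need not be affine
  -- along coordinate lines.
  obtain ⟨x, hx⟩ := exists_mem_of_finset Λ
    (fun p => {x | Function.Surjective (LinearMap.pi fun i =>
        ∑ j, C p i j • SurjectiveCapacity.contract
          (fun j => (f j).baseChange p.asIdeal.ResidueField) x j)})
    (fun p hp => ⟨x₀ p, hx₀ p hp⟩) (by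
      classical
      intro p hp y hy i
      obtain ⟨u, v, huv⟩ := exists_update_contract
        (fun j => (f j).baseChange p.asIdeal.ResidueField) y i
      have hlin : ∀ c, (LinearMap.pi fun i' => ∑ j, C p i' j • SurjectiveCapacity.contract
          (fun j => (f j).baseChange p.asIdeal.ResidueField) (Function.update y i c) j) =
          (LinearMap.pi fun i' => ∑ j, C p i' j • u j) +
            c • (LinearMap.pi fun i' => ∑ j, C p i' j • v j) := fun c => by
        refine LinearMap.ext fun w => funext fun i' => ?_
        simp only [huv, LinearMap.pi_apply, LinearMap.add_apply, LinearMap.smul_apply,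
          Pi.add_apply, Pi.smul_apply, LinearMap.sum_apply, smul_add, Finset.sum_add_distrib,
          Finset.smul_sum, smul_comm c]
      have h0 := hlin (y i)
      rw [Function.update_eq_self] at h0
      refine (finite_not_surjective_line (u := LinearMap.pi fun i' => ∑ j, C p i' j • u j)
        (c₀ := y i)
        (v := LinearMap.pi fun i' => ∑ j, C p i' j • v j) (h0 ▸ hy.out)).subset fun c hc => ?_
      simp only [Set.mem_ofPred_eq] at hc ⊢
      rw [← hlin]
      convert hc)
  refine ⟨x, fun p hp => ⟨_, fun i => ?_, hx p hp⟩⟩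
  refine Submodule.sum_mem _ fun j _ => Submodule.smul_mem _ _ (Submodule.subset_span ⟨j, ?_⟩)
  exact baseChange_contract f x j

end Fibre

/-! ### Generic points and dimension in the j-spectrum. -/

section Spectrum

variable {R : Type*} [CommRing R]

theorem mem_jSpec_iff {p : PrimeSpectrum R} : p ∈ jSpec R ↔ p.asIdeal.jacobson = p.asIdeal := by
  rw [Ideal.eq_jacobson_iff_sInf_maximal]
  constructor
  · rintro ⟨T, hT, h⟩
    exact ⟨T, fun J hJ => Or.inl (hT J hJ), h⟩
  · rintro ⟨T, hT, h⟩
    refine ⟨{J ∈ T | J ≠ ⊤}, fun m hm => (hT m hm.1).resolve_right hm.2, h.trans ?_⟩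
    refine le_antisymm (sInf_le_sInf fun J hJ => hJ.1) (le_sInf fun J hJ => ?_)
    by_cases hJ' : J = ⊤
    · rw [hJ']
      exact le_top
    · exact sInf_le ⟨hJ, hJ'⟩

/-- The minimal primes of an intersection of maximal ideals in a Noetherian ring are
intersections of maximal ideals. -/
theorem jacobson_eq_self_of_mem_minimalPrimes [IsNoetherianRing R] {I q : Ideal R}
    (hI : I.jacobson = I) (hq : q ∈ I.minimalPrimes) : q.jacobson = q := by
  have hfin := I.finite_minimalPrimes_of_isNoetherianRing
  -- Each maximal ideal over `I` contains one of the finitely many minimal primes, hence its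
  -- Jacobson radical. As `q` is prime, it then contains one of these radicals.
  have h1 : hfin.toFinset.inf (fun J => J.jacobson) ≤ I := by
    refine le_trans ?_ hI.le
    refine le_sInf fun m hm => ?_
    have := hm.2.isPrime
    obtain ⟨J, hJ, hJm⟩ := Ideal.exists_minimalPrimes_le hm.1
    exact (Finset.inf_le (hfin.mem_toFinset.mpr hJ)).trans (sInf_le ⟨hJm, hm.2⟩)
  have := hq.1.1
  obtain ⟨J, hJ, hJq⟩ := (Ideal.IsPrime.inf_le' this).mp (h1.trans hq.1.2)
  have hJ' := hfin.mem_toFinset.mp hJ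
  have hle : J ≤ q := Ideal.le_jacobson.trans hJq
  obtain rfl : J = q := le_antisymm hle (hq.2 hJ'.1 hle)
  exact le_antisymm hJq Ideal.le_jacobson

/-- The points of a closed subset of `j-Spec R` specialize finitely many of its points. -/
theorem exists_finset_generic [IsNoetherianRing R] {Z : Set (PrimeSpectrum R)} (hZ : IsClosed Z) :
    ∃ Λ : Finset (PrimeSpectrum R), (∀ q ∈ Λ, q ∈ jSpec R ∩ Z) ∧
      ∀ p ∈ jSpec R ∩ Z, ∃ q ∈ Λ, q ≤ p := by
  set I := PrimeSpectrum.vanishingIdeal (jSpec R ∩ Z) with hI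
  have hle : ∀ p ∈ jSpec R ∩ Z, I ≤ p.asIdeal := fun p hp x hx =>
    (PrimeSpectrum.mem_vanishingIdeal _ _).mp hx p hp
  have hjac : I.jacobson = I := by
    refine le_antisymm (fun x hx => ?_) Ideal.le_jacobson
    refine (PrimeSpectrum.mem_vanishingIdeal _ _).mpr fun p hp => ?_
    have := Ideal.jacobson_mono (hle p hp) hx
    rwa [mem_jSpec_iff.mp hp.1] at this
  have hfin : {q : PrimeSpectrum R | q.asIdeal ∈ I.minimalPrimes}.Finite :=
    I.finite_minimalPrimes_of_isNoetherianRing.preimage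
      (fun p _ q _ h => PrimeSpectrum.ext h)
  refine ⟨hfin.toFinset, fun q hq => ?_, fun p hp => ?_⟩
  · have hq' : q.asIdeal ∈ I.minimalPrimes := hfin.mem_toFinset.mp hq
    refine ⟨mem_jSpec_iff.mpr (jacobson_eq_self_of_mem_minimalPrimes hjac hq'), ?_⟩
    rw [← hZ.closure_eq, ← PrimeSpectrum.zeroLocus_vanishingIdeal_eq_closure]
    exact (PrimeSpectrum.vanishingIdeal_anti_mono Set.inter_subset_right).trans hq'.1.2
  · obtain ⟨J, hJ, hJp⟩ := Ideal.exists_minimalPrimes_le (hle p hp)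
    exact ⟨⟨J, hJ.1.1⟩, hfin.mem_toFinset.mpr hJ, hJp⟩

/-- The whole of `V(p) ∩ X` is irreducible if `p ∈ X`. -/
theorem isIrreducible_univ_inter {X : Set (PrimeSpectrum R)} {p : PrimeSpectrum R} (hp : p ∈ X) :
    IsIrreducible (Set.univ : Set ↥({q : PrimeSpectrum R | p.asIdeal ≤ q.asIdeal} ∩ X)) := by
  have hp' : p ∈ {q : PrimeSpectrum R | p.asIdeal ≤ q.asIdeal} ∩ X := ⟨le_refl p.asIdeal, hp⟩
  have : closure {(⟨p, hp'⟩ : ↥({q : PrimeSpectrum R | p.asIdeal ≤ q.asIdeal} ∩ X))} =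
      Set.univ := by
    refine Set.eq_univ_of_forall fun q => ?_
    rw [closure_subtype, Set.image_singleton]
    exact (PrimeSpectrum.le_iff_mem_closure p q.1).mp q.2.1
  rw [← this]
  exact isIrreducible_singleton.closure

/-- Closures in `V(q) ∩ X` of irreducible closed sets of `V(p) ∩ X` stay inside `V(p)`, so they miss
`q`, and the irreducible whole space can be put on top of every chain. -/
theorem dimAt_add_one_le {X : Set (PrimeSpectrum R)} {p q : PrimeSpectrum R} (hp : p ∈ X)
    (hq : q ∈ X) (hqp : q < p) : dimAt X p + 1 ≤ dimAt X q := by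
  have hsub : {x : PrimeSpectrum R | p.asIdeal ≤ x.asIdeal} ∩ X ⊆
      {x : PrimeSpectrum R | q.asIdeal ≤ x.asIdeal} ∩ X := fun x hx =>
    ⟨le_trans (show q.asIdeal ≤ p.asIdeal from hqp.le) hx.1, hx.2⟩
  have hind := (Topology.IsEmbedding.inclusion hsub).isInducing
  let top : TopologicalSpace.IrreducibleCloseds
      ↥({x : PrimeSpectrum R | q.asIdeal ≤ x.asIdeal} ∩ X) :=
    ⟨Set.univ, isIrreducible_univ_inter hq, isClosed_univ⟩
  have : Nonempty (TopologicalSpace.IrreducibleCloseds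
      ↥({x : PrimeSpectrum R | p.asIdeal ≤ x.asIdeal} ∩ X)) :=
    ⟨⟨Set.univ, isIrreducible_univ_inter hp, isClosed_univ⟩⟩
  have hmono := TopologicalSpace.IrreducibleCloseds.map_strictMono_of_isInducing hind
  have htop : ∀ s, TopologicalSpace.IrreducibleCloseds.map _ hind.continuous s < top := by
    intro s
    refine lt_of_le_of_ne (fun x _ => Set.mem_univ x) fun h => ?_
    have hcl : IsClosed {x : ↥({x : PrimeSpectrum R | q.asIdeal ≤ x.asIdeal} ∩ X) |
        p.asIdeal ≤ x.1.asIdeal} :=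
      (PrimeSpectrum.isClosed_zeroLocus (p.asIdeal : Set R)).preimage continuous_subtype_val
    have h1 : (⟨q, le_refl q.asIdeal, hq⟩ :
        ↥({x : PrimeSpectrum R | q.asIdeal ≤ x.asIdeal} ∩ X)) ∈
        TopologicalSpace.IrreducibleCloseds.map _ hind.continuous s := by
      rw [h]
      exact Set.mem_univ _
    have h2 := closure_minimal (t := {x : ↥({x : PrimeSpectrum R | q.asIdeal ≤ x.asIdeal} ∩ X) |
        p.asIdeal ≤ x.1.asIdeal}) (by rintro _ ⟨x, _, rfl⟩; exact x.2.1) hcl h1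
    exact absurd (show p ≤ q from h2) (not_le_of_gt hqp)
  unfold dimAt topologicalKrullDim
  rw [← Order.krullDim_WithTop]
  refine Order.krullDim_le_of_strictMono (fun s => WithTop.recTopCoe top
    (fun s => TopologicalSpace.IrreducibleCloseds.map _ hind.continuous s) s) fun s s' h => ?_
  cases s with
  | top => exact absurd h not_top_lt
  | coe s =>
    cases s' with
    | top => exact htop s
    | coe s' => exact hmono (WithTop.coe_lt_coe.mp h)

theorem exists_dimAt_eq_natCast {X : Set (PrimeSpectrum R)} (hX : topologicalKrullDim ↥X < ⊤)
    {p : PrimeSpectrum R} (hp : p ∈ X) : ∃ d : ℕ, dimAt X p = ((d : ℕ∞) : WithBot ℕ∞) := by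
  have : Nonempty (TopologicalSpace.IrreducibleCloseds
      ↥({x : PrimeSpectrum R | p.asIdeal ≤ x.asIdeal} ∩ X)) :=
    ⟨⟨Set.univ, isIrreducible_univ_inter hp, isClosed_univ⟩⟩
  have h0 : 0 ≤ dimAt X p := Order.krullDim_nonneg
  have h1 : dimAt X p < ⊤ := lt_of_le_of_lt
    (Topology.IsInducing.topologicalKrullDim_le
      (Topology.IsEmbedding.inclusion Set.inter_subset_right).isInducing) hX
  generalize dimAt X p = d at h0 h1
  cases d with
  | bot => simp at h0
  | coe d =>
    cases d with
    | top => exact absurd h1 (lt_irrefl _)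
    | coe d => exact ⟨d, rfl⟩

end Spectrum

/-! ### Shortening the family, and the passage from local to global. -/

section Descent

variable {R : Type*} [CommRing R] {M N : Type*} [AddCommGroup M] [Module R M]
  [AddCommGroup N] [Module R N]

theorem mem_support_of_mem_support_pi_quotient {m : ℕ} (Q : Submodule R (Fin m → N))
    {p : PrimeSpectrum R} (hp : p ∈ Module.support R ((Fin m → N) ⧸ Q)) :
    p ∈ Module.support R N := by
  by_contra h
  rw [Module.notMem_support_iff'] at h
  refine Module.notMem_support_iff'.mpr ?_ hp
  intro y
  obtain ⟨y, rfl⟩ := Submodule.Quotient.mk_surjective _ y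
  choose r hr hy using fun i => h (y i)
  refine ⟨∏ i, r i, fun hm => ?_, ?_⟩
  · obtain ⟨i, -, hi⟩ := (Ideal.IsPrime.prod_mem_iff (hp := p.isPrime)).mp hm
    exact hr i hi
  · rw [← Submodule.Quotient.mk_smul]
    have : (∏ i, r i) • y = 0 := funext fun i => by
      rw [Pi.smul_apply, ← Finset.prod_erase_mul _ _ (Finset.mem_univ i), mul_smul, hy, smul_zero,
        Pi.zero_apply]
    rw [this, Submodule.Quotient.mk_zero]

variable [Module.Finite R N]

/-- Surjectivity onto a power of `N` may be tested on `j-Spec R ∩ Supp N`. -/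
theorem surjective_pi_of_fibreRank {n : ℕ} {f : Fin n → M →ₗ[R] N}
    (h : ∀ p ∈ jSpec R ∩ Module.support R N, FibreRank p n f) :
    Function.Surjective (LinearMap.pi f) := by
  by_contra hns
  have hnt : Nontrivial ((Fin n → N) ⧸ LinearMap.range (LinearMap.pi f)) :=
    Submodule.Quotient.nontrivial_iff.mpr fun h => hns (LinearMap.range_eq_top.mp h)
  obtain ⟨p, hp⟩ := Module.nonempty_support_of_nontrivial (R := R)
    (M := (Fin n → N) ⧸ LinearMap.range (LinearMap.pi f))
  -- The support of the cokernel is stable under specialization, so it contains a maximal ideal,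
  -- which belongs to the j-spectrum.
  obtain ⟨m, hm, hpm⟩ := Ideal.exists_le_maximal p.asIdeal p.isPrime.ne_top
  let q : PrimeSpectrum R := ⟨m, hm.isPrime⟩
  have hq := Module.mem_support_mono (show p ≤ q from hpm) hp
  have hqX : q ∈ jSpec R ∩ Module.support R N :=
    ⟨⟨{m}, by simpa using hm, by simp [q]⟩, mem_support_of_mem_support_pi_quotient _ hq⟩
  exact (surjective_baseChange_residueField_iff _ q).mp
    ((surjective_pi_baseChange_iff f).mp (SurjRank.surjective_pi (h q hqX))) hq

variable [IsNoetherianRing R]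

/-- One contraction step: if the rank at every `p` is at least `min (n + 1) (t + dim p)`, it can be
made at least `min n (t + dim p)` with one map less. -/
theorem exists_contract_forall_fibreRank {X : Set (PrimeSpectrum R)}
    (hX : X = jSpec R ∩ Module.support R N) {d : PrimeSpectrum R → ℕ}
    (hd : ∀ p ∈ X, ∀ q ∈ X, q < p → d p + 1 ≤ d q) {t n : ℕ} {f : Fin (n + 1) → M →ₗ[R] N}
    (hf : ∀ p ∈ X, FibreRank p (min (n + 1) (t + d p)) f) :
    ∃ x : Fin n ⊕ Fin n → R, ∀ p ∈ X, FibreRank p (min n (t + d p)) (contract f x) := by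
  classical
  have hfin : ∀ m, ∃ Λ : Finset (PrimeSpectrum R),
      (∀ q ∈ Λ, q ∈ X ∧ ¬ FibreRank q m f) ∧
      ∀ p ∈ X, ¬ FibreRank p m f → ∃ q ∈ Λ, q ≤ p := fun m => by
    obtain ⟨Λ, h1, h2⟩ := exists_finset_generic
      ((Module.isClosed_support (R := R) (M := N)).inter (isClosed_setOf_not_fibreRank m f))
    subst hX
    exact ⟨Λ, fun q hq => ⟨⟨(h1 q hq).1, (h1 q hq).2.1⟩, (h1 q hq).2.2⟩,
      fun p hp hpm => h2 p ⟨hp.1, hp.2, hpm⟩⟩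
  choose Λ hΛ hgen using hfin
  -- The thresholds needed below are `min n (t + d p) + 1`, which are at most `n + 1`.
  let Λ' := (Finset.range (n + 2)).biUnion Λ
  have hΛ' : ∀ p ∈ Λ', p ∈ X := fun p hp => by
    obtain ⟨m, _, hm⟩ := Finset.mem_biUnion.mp hp
    exact (hΛ m p hm).1
  obtain ⟨x, hx⟩ := exists_contract_fibreRank f Λ' (fun p => min n (t + d p))
    (fun p _ => min_le_left _ _)
    (fun p hp => (hf p (hΛ' p hp)).mono (by omega))
  refine ⟨x, fun p hp => ?_⟩
  by_cases hpΛ : p ∈ Λ'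
  · exact hx p hpΛ
  -- Rank one above the target suffices here. Were it missing, a generic point `q < p` of that locus
  -- would have `d q ≥ d p + 1`, against `hf` at `q`.
  · refine FibreRank.contract ?_ x
    by_contra hcon
    obtain ⟨q, hq, hqp⟩ := hgen _ p hp hcon
    have hqΛ : q ∈ Λ' := Finset.mem_biUnion.mpr
      ⟨_, Finset.mem_range.mpr (by omega), hq⟩
    have hlt : q < p := lt_of_le_of_ne hqp (by rintro rfl; exact hpΛ hqΛ)
    have hqX := (hΛ _ q hq).1
    have := hd p hp q hqX hlt
    exact (hΛ _ q hq).2 ((hf q hqX).mono (by omega))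

theorem exists_surjective_of_fibreRank {X : Set (PrimeSpectrum R)}
    (hX : X = jSpec R ∩ Module.support R N) {d : PrimeSpectrum R → ℕ}
    (hd : ∀ p ∈ X, ∀ q ∈ X, q < p → d p + 1 ≤ d q) (H : Submodule R (M →ₗ[R] N)) {t n : ℕ}
    (ht : t ≤ n) (f : Fin n → M →ₗ[R] N) (hfH : ∀ j, f j ∈ H)
    (hf : ∀ p ∈ X, FibreRank p (min n (t + d p)) f) :
    ∃ g : Fin t → M →ₗ[R] N, (∀ i, g i ∈ H) ∧ Function.Surjective (LinearMap.pi g) := by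
  induction n, ht using Nat.le_induction with
  | base =>
    refine ⟨f, hfH, surjective_pi_of_fibreRank fun p hp => ?_⟩
    rw [← hX] at hp
    exact (hf p hp).mono (by omega)
  | succ n hn ih =>
    obtain ⟨x, hx⟩ := exists_contract_forall_fibreRank hX hd hf
    exact ih _ (fun j => H.add_mem (hfH _) (H.smul_mem _ (H.add_mem (hfH _)
      (H.sum_mem fun l _ => H.smul_mem _ (hfH _))))) hx

/-- If at every `p ∈ X` some `t + dim p` elements of `H ⊆ Hom(M, N)` are jointly surjective, then
some `t` elements of `H` are jointly surjective. -/
theorem exists_surjective_of_local [Module.Finite R M] {X : Set (PrimeSpectrum R)}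
    (hX : X = jSpec R ∩ Module.support R N) {d : PrimeSpectrum R → ℕ}
    (hd : ∀ p ∈ X, ∀ q ∈ X, q < p → d p + 1 ≤ d q) (H : Submodule R (M →ₗ[R] N)) (t : ℕ)
    (hloc : ∀ p ∈ X, ∃ h : Fin (t + d p) → M →ₗ[R] N, (∀ i, h i ∈ H) ∧
      p ∉ Module.support R ((Fin (t + d p) → N) ⧸ LinearMap.range (LinearMap.pi h))) :
    ∃ g : Fin t → M →ₗ[R] N, (∀ i, g i ∈ H) ∧ Function.Surjective (LinearMap.pi g) := by
  obtain ⟨n, f, hf⟩ := Submodule.fg_iff_exists_fin_generating_family.mp (IsNoetherian.noetherian H)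
  have hfH : ∀ j, f j ∈ H := fun j => hf ▸ Submodule.subset_span ⟨j, rfl⟩
  -- Padding by `t` zero maps ensures that the family has at least `t` members.
  have hle : H ≤ Submodule.span R (Set.range (Fin.append f (fun _ : Fin t => 0))) := by
    rw [← hf]
    refine Submodule.span_mono ?_
    rintro _ ⟨j, rfl⟩
    exact ⟨Fin.castAdd t j, Fin.append_left _ _ _⟩
  refine exists_surjective_of_fibreRank hX hd H (Nat.le_add_left t n)
    (Fin.append f (fun _ : Fin t => 0)) (fun j => ?_) fun p hp => ?_
  · induction j using Fin.addCases with
    | left j => rw [Fin.append_left]; exact hfH j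
    | right j => rw [Fin.append_right]; exact H.zero_mem
  · obtain ⟨h, hh, hs⟩ := hloc p hp
    exact (fibreRank_iff.mpr ⟨h, fun i => hle (hh i), hs⟩).mono (min_le_right _ _)

end Descent

/-! ### Clearing denominators in maps of localized right modules. -/

section Localization

variable {R : Type*} [CommRing R] (P : Submonoid R)
variable {S : Type*} [Ring S] [Algebra R S]
variable {M : Type*} [AddCommGroup M] [Module R M] [Module Sᵐᵒᵖ M] [IsScalarTower R Sᵐᵒᵖ M]
variable {N : Type*} [AddCommGroup N] [Module R N] [Module Sᵐᵒᵖ N] [IsScalarTower R Sᵐᵒᵖ N]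

/-- Scalars from `R` act through `P⁻¹S`, so maps linear over `P⁻¹S` are `R`-linear. -/
theorem smul_eq_op_mk_smul (r : R) (x : LocalizedModule P M) :
    r • x = MulOpposite.op (LocalizedModule.mk (algebraMap R S r) (1 : P)) • x := by
  induction x with | _ m s
  rw [op_mk_smul_mk, LocalizedModule.smul'_mk, mul_one, Algebra.algebraMap_eq_smul_one,
    op_smul_algebra_smul, MulOpposite.op_one, one_smul]

theorem smul_op_mk_smul (r : R) (a : S) (x : LocalizedModule P M) :
    r • MulOpposite.op (LocalizedModule.mk a (1 : P)) • x =
      MulOpposite.op (LocalizedModule.mk a (1 : P)) • r • x := by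
  induction x with | _ m s
  rw [op_mk_smul_mk, LocalizedModule.smul'_mk, LocalizedModule.smul'_mk, op_mk_smul_mk,
    op_smul_smul]

/-- The `R`-linear map underlying a map linear over the localized ring. -/
def toLinearMap (g : LocalizedModule P M →ₗ[(LocalizedModule P S)ᵐᵒᵖ] LocalizedModule P N) :
    LocalizedModule P M →ₗ[R] LocalizedModule P N where
  toFun := g
  map_add' := map_add g
  map_smul' r x := by
    rw [smul_eq_op_mk_smul (S := S), map_smul, ← smul_eq_op_mk_smul (S := S), RingHom.id_apply]

/-- In a Noetherian module a single element of `P` kills the kernel of localization at `P`. -/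
theorem exists_smul_eq_zero_of_mk_eq_zero [IsNoetherian R N] :
    ∃ c ∈ P, ∀ y : N, LocalizedModule.mk y (1 : P) = 0 → c • y = 0 := by
  classical
  obtain ⟨s, hs⟩ := IsNoetherian.noetherian (LinearMap.ker (LocalizedModule.mkLinearMap P N))
  have : ∀ y ∈ s, ∃ c ∈ P, c • y = 0 := fun y hy => by
    have h1 : y ∈ LinearMap.ker (LocalizedModule.mkLinearMap P N) :=
      hs ▸ Submodule.subset_span hy
    obtain ⟨c, hc⟩ := (IsLocalizedModule.eq_zero_iff P (LocalizedModule.mkLinearMap P N)).mp h1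
    exact ⟨c, c.2, hc⟩
  choose! c hcP hc using this
  refine ⟨∏ y ∈ s, c y, P.prod_mem hcP, fun y hy => ?_⟩
  have hy' : y ∈ Submodule.span R (s : Set N) := hs ▸ hy
  have hle : Submodule.span R (s : Set N) ≤ LinearMap.ker (LinearMap.lsmul R N (∏ y ∈ s, c y)) := by
    rw [Submodule.span_le]
    intro z hz
    rw [SetLike.mem_coe, LinearMap.mem_ker, LinearMap.lsmul_apply,
      ← Finset.prod_erase_mul _ _ hz, mul_smul, hc z hz, smul_zero]
  exact hle hy'

/-- Maps of right modules over the localized ring are fractions of maps over `S`. -/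
theorem exists_eq_smul_localized [IsNoetherianRing R] [Module.Finite R M] [Module.Finite R N]
    (g : LocalizedModule P M →ₗ[(LocalizedModule P S)ᵐᵒᵖ] LocalizedModule P N) :
    ∃ h : M →ₗ[Sᵐᵒᵖ] N, ∃ s ∈ P, ∀ x : M,
      LocalizedModule.mk (h x) (1 : P) = s • g (LocalizedModule.mk x 1) := by
  have : Module.FinitePresentation R M := Module.finitePresentation_of_finite R M
  obtain ⟨h₀, s, hs⟩ := Module.FinitePresentation.exists_lift_of_isLocalizedModule P
    (LocalizedModule.mkLinearMap P N) (toLinearMap P g ∘ₗ LocalizedModule.mkLinearMap P M)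
  have hs' : ∀ x, LocalizedModule.mk (h₀ x) (1 : P) = (s : R) • g (LocalizedModule.mk x 1) :=
    fun x => LinearMap.congr_fun hs x
  obtain ⟨c, hcP, hc⟩ := exists_smul_eq_zero_of_mk_eq_zero P (N := N)
  -- The lift `h₀` is only `R`-linear. Its failure to commute with `S` dies in `P⁻¹N`, so the
  -- uniform annihilator `c` removes it.
  have hlin : ∀ (a : S) (x : M), c • h₀ (MulOpposite.op a • x) =
      MulOpposite.op a • (c • h₀ x) := fun a x => by
    rw [op_smul_smul, ← sub_eq_zero, ← smul_sub]
    refine hc _ ?_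
    change LocalizedModule.mkLinearMap P N _ = 0
    rw [map_sub, sub_eq_zero, LocalizedModule.mkLinearMap_apply,
      LocalizedModule.mkLinearMap_apply, hs']
    have h1 : LocalizedModule.mk (MulOpposite.op a • x) (1 : P) =
        MulOpposite.op (LocalizedModule.mk a (1 : P)) • LocalizedModule.mk x (1 : P) := by
      rw [op_mk_smul_mk, mul_one]
    have h2 : LocalizedModule.mk (MulOpposite.op a • h₀ x) (1 : P) =
        MulOpposite.op (LocalizedModule.mk a (1 : P)) • LocalizedModule.mk (h₀ x) (1 : P) := by
      rw [op_mk_smul_mk, mul_one]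
    rw [h1, h2, map_smul, hs', smul_op_mk_smul]
  refine ⟨⟨⟨fun x => c • h₀ x, fun x y => by rw [map_add, smul_add]⟩, fun a x => ?_⟩, c * s,
    P.mul_mem hcP s.2, fun x => ?_⟩
  · exact hlin a.unop x
  · rw [mul_smul, ← hs', LocalizedModule.smul'_mk]
    rfl

/-- The `R`-module of `S`-linear maps inside the `R`-linear maps. -/
def linearMaps (R S M N : Type*) [CommRing R] [Ring S] [Algebra R S]
    [AddCommGroup M] [Module R M] [Module Sᵐᵒᵖ M] [IsScalarTower R Sᵐᵒᵖ M]
    [AddCommGroup N] [Module R N] [Module Sᵐᵒᵖ N] [IsScalarTower R Sᵐᵒᵖ N] :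
    Submodule R (M →ₗ[R] N) where
  carrier := {f | ∀ (a : S) (x : M), f (MulOpposite.op a • x) = MulOpposite.op a • f x}
  add_mem' hf hg a x := by
    rw [LinearMap.add_apply, LinearMap.add_apply, hf a x, hg a x, smul_add]
  zero_mem' a x := by simp
  smul_mem' r f hf a x := by
    rw [LinearMap.smul_apply, LinearMap.smul_apply, hf a x, op_smul_smul]

/-- A surjection of localized right modules onto a power comes from maps over `S`, up to units. -/
theorem exists_notMem_support_of_surjective [IsNoetherianRing R] [Module.Finite R M]
    [Module.Finite R N] (p : PrimeSpectrum R) {m : ℕ}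
    (G : LocalizedModule p.asIdeal.primeCompl M →ₗ[(LocalizedModule p.asIdeal.primeCompl S)ᵐᵒᵖ]
      (Fin m → LocalizedModule p.asIdeal.primeCompl N)) (hG : Function.Surjective G) :
    ∃ h : Fin m → M →ₗ[R] N, (∀ i, h i ∈ linearMaps R S M N) ∧
      p ∉ Module.support R ((Fin m → N) ⧸ LinearMap.range (LinearMap.pi h)) := by
  have := fun i => exists_eq_smul_localized p.asIdeal.primeCompl ((LinearMap.proj i).comp G)
  choose h s hsP hs using this
  refine ⟨fun i => (h i).restrictScalars R, fun i a x => (h i).map_smul _ x, ?_⟩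
  rw [Module.notMem_support_iff']
  intro y
  obtain ⟨y, rfl⟩ := Submodule.Quotient.mk_surjective _ y
  -- The denominators `s i` cancel the factors by which `h i` differs from `G`: if `x / u` maps to
  -- `(y i / s i)`, then `h i x` and `u • y i` agree in the localization.
  obtain ⟨x, hx⟩ := hG fun i => LocalizedModule.mk (y i) ⟨s i, hsP i⟩
  induction x with | _ x u
  have key : ∀ i, ∃ c ∈ p.asIdeal.primeCompl, c • h i x = c • (u : R) • y i := by
    intro i
    have h1 := congrFun hx i
    have h2 : toLinearMap (S := S) p.asIdeal.primeCompl ((LinearMap.proj i).comp G)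
        ((u : R) • LocalizedModule.mk x u) =
        (u : R) • LocalizedModule.mk (y i) ⟨s i, hsP i⟩ := by
      rw [map_smul, ← h1]
      rfl
    have h3 : (u : R) • LocalizedModule.mk x u =
        LocalizedModule.mk x (1 : p.asIdeal.primeCompl) := by
      rw [LocalizedModule.smul'_mk]
      exact LocalizedModule.mk_cancel u x
    have h4 : LocalizedModule.mk (h i x) (1 : p.asIdeal.primeCompl) =
        LocalizedModule.mk ((u : R) • y i) 1 := by
      rw [hs]
      rw [h3] at h2
      refine (congrArg (s i • ·) h2).trans ?_
      rw [smul_comm, ← LocalizedModule.smul'_mk, LocalizedModule.smul'_mk (s i)]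
      exact congrArg _ (LocalizedModule.mk_cancel (⟨s i, hsP i⟩ : p.asIdeal.primeCompl) (y i))
    obtain ⟨c, hc⟩ := LocalizedModule.mk_eq.mp h4
    refine ⟨c, c.2, ?_⟩
    simpa [Submonoid.smul_def] using hc
  choose c hcP hc using key
  refine ⟨(∏ i, c i) * u, fun hm => ?_, ?_⟩
  · rcases p.isPrime.mem_or_mem hm with hm | hm
    · obtain ⟨i, -, hi⟩ := (Ideal.IsPrime.prod_mem_iff (hp := p.isPrime)).mp hm
      exact hcP i hi
    · exact u.2 hm
  · rw [← Submodule.Quotient.mk_smul, Submodule.Quotient.mk_eq_zero]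
    refine ⟨(∏ i, c i) • x, funext fun i => ?_⟩
    rw [map_smul, Pi.smul_apply, Pi.smul_apply, LinearMap.pi_apply, LinearMap.restrictScalars_apply,
      ← Finset.prod_erase_mul _ _ (Finset.mem_univ i), mul_smul, mul_smul, mul_smul, hc]

end Localization

/-! ### Arithmetic of the surjective capacity. -/

section Capacity

/-- A surjection onto `N ^ m` exists if `m` is at most the surjective capacity. -/
theorem exists_surjective_of_le_sur {A M N : Type*} [Ring A] [AddCommGroup M] [Module Aᵐᵒᵖ M]
    [AddCommGroup N] [Module Aᵐᵒᵖ N] {m : ℕ} (h : (m : ℕ∞) ≤ sur A M N) :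
    ∃ f : M →ₗ[Aᵐᵒᵖ] (Fin m → N), Function.Surjective f := by
  cases m with
  | zero => exact ⟨0, fun w => ⟨0, Subsingleton.elim _ _⟩⟩
  | succ m =>
    -- An infinite supremum is not attained, so a member of the set beyond `m` is found first and
    -- then truncated to `m + 1` components.
    have h1 : (m : ℕ∞) < sur A M N := lt_of_lt_of_le (by exact_mod_cast m.lt_succ_self) h
    obtain ⟨t, ht, hmt⟩ := lt_biSup_iff.mp h1
    obtain ⟨f, hf⟩ := ht
    have hmt' : m + 1 ≤ t := by exact_mod_cast hmt
    exact ⟨_, surjective_pi_comp (h := fun i => (LinearMap.proj i).comp f) hf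
      (Fin.castLE_injective hmt')⟩

theorem le_sur {A M N : Type*} [Ring A] [AddCommGroup M] [Module Aᵐᵒᵖ M]
    [AddCommGroup N] [Module Aᵐᵒᵖ N] {m : ℕ} (f : M →ₗ[Aᵐᵒᵖ] (Fin m → N))
    (hf : Function.Surjective f) : (m : ℕ∞) ≤ sur A M N :=
  le_biSup (fun t : ℕ => (t : ℕ∞)) (show m ∈ {_t : ℕ | _} from ⟨f, hf⟩)

theorem add_one_add_le_of_lt_sub {a : ℕ∞} {s d : ℕ}
    (h : ((s : ℕ∞) : EReal) < (a : EReal) - dimToEReal ((d : ℕ∞) : WithBot ℕ∞)) :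
    ((s + 1 + d : ℕ) : ℕ∞) ≤ a := by
  cases a with
  | top => exact le_top
  | coe a =>
    have h1 : ((s : ℝ) : EReal) < ((a : ℝ) : EReal) - ((d : ℝ) : EReal) := h
    rw [← EReal.coe_sub, EReal.coe_lt_coe_iff, lt_sub_iff_add_lt] at h1
    have h2 : s + d < a := by exact_mod_cast h1
    have h3 : s + 1 + d ≤ a := by omega
    exact_mod_cast h3

end Capacity

end SurjectiveCapacity

/-! ### The main theorem. -/

open SurjectiveCapacity in
theorem theorem0p8 {R : Type*} [CommRing R] [IsNoetherianRing R]
    {S : Type*} [Ring S] [Algebra R S] [Module.Finite R S]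
    {M : Type*} [AddCommGroup M] [Module R M] [Module Sᵐᵒᵖ M] [IsScalarTower R Sᵐᵒᵖ M]
    [Module.Finite Sᵐᵒᵖ M]
    {N : Type*} [AddCommGroup N] [Module R N] [Module Sᵐᵒᵖ N] [IsScalarTower R Sᵐᵒᵖ N]
    [Module.Finite Sᵐᵒᵖ N]
    (X : Set (PrimeSpectrum R)) (hX : X = jSpec R ∩ Module.support R N)
    (hdim : topologicalKrullDim ↥X < ⊤) :
    (⨅ p ∈ X,
        ((sur (LocalizedModule p.asIdeal.primeCompl S)
            (LocalizedModule p.asIdeal.primeCompl M)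
            (LocalizedModule p.asIdeal.primeCompl N) : ℕ∞) : EReal)
          - dimToEReal (dimAt X p))
      ≤ ((sur S M N : ℕ∞) : EReal) := by
  have hS : Module.Finite R Sᵐᵒᵖ := Module.Finite.equiv (MulOpposite.opLinearEquiv R)
  have hM : Module.Finite R M := Module.Finite.trans Sᵐᵒᵖ M
  have hN : Module.Finite R N := Module.Finite.trans Sᵐᵒᵖ N
  by_contra! hcon
  obtain ⟨s, hs⟩ : ∃ s : ℕ, sur S M N = s := by
    refine ⟨_, (ENat.natCast_toNat fun htop => ?_).symm⟩
    rw [htop] at hcon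
    exact not_top_lt hcon
  rw [hs] at hcon
  have hd := fun p (hp : p ∈ X) => exists_dimAt_eq_natCast hdim hp
  choose! d hd using hd
  have hmono : ∀ p ∈ X, ∀ q ∈ X, q < p → d p + 1 ≤ d q := fun p hp q hq hqp => by
    have := dimAt_add_one_le hp hq hqp
    rw [hd p hp, hd q hq] at this
    exact_mod_cast this
  -- The strict inequality `s < sur - dim` between integers or `∞` leaves room for `s + 1` copies,
  -- contradicting that `s` is the supremum.
  obtain ⟨g, hgH, hg⟩ := exists_surjective_of_local hX hmono (linearMaps R S M N) (s + 1)
    fun p hp => by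
      have h1 := lt_of_lt_of_le hcon (iInf₂_le p hp)
      rw [hd p hp] at h1
      obtain ⟨G, hG⟩ := exists_surjective_of_le_sur (add_one_add_le_of_lt_sub h1)
      exact exists_notMem_support_of_surjective p G hG
  let g' : Fin (s + 1) → M →ₗ[Sᵐᵒᵖ] N := fun i =>
    ⟨⟨g i, map_add (g i)⟩, fun a x => hgH i a.unop x⟩
  have hle := le_sur (LinearMap.pi g') hg
  rw [hs] at hle
  have : s + 1 ≤ s := by exact_mod_cast hle
  omega
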